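/- **Notation.** For a set $X$ let $UX$ be the set of ultrafilters on $X$, $\dot x\in UX$ the principal ultrafilter of $x\in X$, $Uf:UX\to UY$ the image map of $f:X\to Y$, and $m_X:UUX\to UX$, $m_X(\mathfrak X)=\{A\subseteq X\mid \{\mathfrak x\in UX\mid A\in\mathfrak x\}\in\mathfrak X\}$. For $u,v\in[0,\infty]$ put $v\ominus u=\max\{v-u,0\}$, where $v\ominus\infty=0$ for all $v$. An *approach space* is a set $X$ with a convergence $a:UX\times X\to[0,\infty]$ such that $a(\dot x,x)=0$ and $a(m_X(\mathfrak X),x)\le Ua(\mathfrak X,\mathfrak x)+a(\mathfrak x,x)$ for all $\mathfrak X\in UUX$, $\mathfrak x\in UX$, $x\in X$, where $Ua(\mathfrak X,\mathfrak x)=\sup_{\mathcal A\in\mathfrak X,A\in\mathfrak x}\inf_{\mathfrak a\in\mathcal A,x\in A}a(\mathfrak a,x)$. A map $f:(X,a)\to(Y,b)$ is an *approach map* if $b(Uf(\mathfrak x),f(x))\le a(\mathfrak x,x)$ for all $\mathfrak x\in UX$, $x\in X$. These form the category $\mathsf{App}$. It is ordered: $x\le y$ in $X$ means $a(\dot x,y)=0$,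 and approach maps are ordered pointwise; $f\dashv g$ means that $f:X\to Y$ and $g:Y\to X$ are approach maps with $1_X\le g f$ and $f g\le 1_Y$. The following approach spaces are used. * $[0,\infty]$ has convergence $(\mathfrak v,v)\mapsto v\ominus\xi(\mathfrak v)$, where $\xi(\mathfrak v)=\sup_{A\in\mathfrak v}\inf A$. A topological space has convergence $0$ if $\mathfrak x\to x$ and $\infty$ otherwise. * $X\oplus Y$ is the set $X\times Y$ with convergence $(\mathfrak w,(x,y))\mapsto a(U\pi_1(\mathfrak w),x)+b(U\pi_2(\mathfrak w),y)$. * Put $\delta(x,A)=\inf\{a(\mathfrak x,x)\mid A\in\mathfrak x\}$, $A^{(\varepsilon)}=\{x\mid\delta(x,A)\le\varepsilon\}$ and $d(\mathfrak x,\mathfrak y)=\inf\{\varepsilon\in[0,\infty]\mid A^{(\varepsilon)}\in\mathfrak y\text{ for all }A\in\mathfrak x\}$ for $\mathfrak x,\mathfrak y\in UX$. Then $UX$ carries the convergence $(\mathfrak X,\mathfrak x)\mapsto d(m_X(\mathfrak X),\mathfrak x)$, and $(UX)^{\mathrm{op}}$ is the set $UX$ with the convergence $(\mathfrak X,\mathfrak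 x)\mapsto d(\mathfrak x,m_X(\mathfrak X))$. * For $X=(UX')^{\mathrm{op}}$ with $X'$ an approach space, or $X$ a compact Hausdorff space, $Y^X$ is the set of approach maps $X\to Y$ with convergence $$(\mathfrak p,h)\mapsto\sup\{b(U\mathrm{ev}(\mathfrak w),h(x))\ominus a(U\pi_2(\mathfrak w),x)\mid x\in X,\ \mathfrak w\in U(Y^X\times X),\ U\pi_1(\mathfrak w)=\mathfrak p\}.$$ * $PX=[0,\infty]^{(UX)^{\mathrm{op}}}$. The *Yoneda embedding* is $X\to PX$, $x\mapsto a(-,x)$. The space $X$ is *absolutely cocomplete* if its Yoneda embedding has a left adjoint in $\mathsf{App}$. A *supremum* of $\psi\in PX$ is a point $x_0\in X$ with $a(\dot x_0,x)=\sup_{\mathfrak x\in UX}(a(\mathfrak x,x)\ominus\psi(\mathfrak x))$ for all $x\in X$; suprema are unique up to equivalence. The space $X$ is *cocomplete* if every $\psi\in PX$ has a supremum; then $\mathrm{Sup}_X:PX\to X$ denotes any map that chooses suprema. **Proposition.** Let $X=(X,a)$ be an approach space. Then $X$ is absolutely cocomplete if and only if $X$ is cocomplete and the following maps are approach maps: 1.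 $+:X\oplus[0,\infty]\to X$, $(x,u)\mapsto\mathrm{Sup}_X(a(-,x)+u)$; 2. $\alpha:UX\to X$, $\mathfrak x\mapsto\mathrm{Sup}_X(d(-,\mathfrak x))$; 3. for every compact Hausdorff space $I$, $\bigvee:X^I\to X$, $\varphi\mapsto\mathrm{Sup}_X\bigl(\inf_{i\in I}a(-,\varphi(i))\bigr)$. (Whether these are approach maps does not depend on the choice of $\mathrm{Sup}_X$.) -/

import Mathlib

open scoped ENNReal Topology

universe u

noncomputable section

/-! Convergence-based approach spaces. Truncated subtraction `v - u` on `[0,∞]` is the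
operation `v ⊖ u`; it satisfies `v - u ≤ w ↔ v ≤ w + u`, with `∞ ⊖ ∞ = 0`. -/

/-- The multiplication `m_X : UUX → UX` of the ultrafilter monad:
`A ∈ m_X 𝔛` iff `{𝔵 | A ∈ 𝔵} ∈ 𝔛`. -/
def ultraJoin {X : Type*} (𝔛 : Ultrafilter (Ultrafilter X)) : Ultrafilter X :=
  𝔛.bind id

theorem mem_ultraJoin {X : Type*} {𝔛 : Ultrafilter (Ultrafilter X)} {A : Set X} :
    A ∈ ultraJoin 𝔛 ↔ {𝔵 : Ultrafilter X | A ∈ 𝔵} ∈ 𝔛 := Iff.rfl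

/-- The extension `Ua(𝔛, 𝔵) = sup_{𝒜 ∈ 𝔛, A ∈ 𝔵} inf_{𝔞 ∈ 𝒜, x ∈ A} a(𝔞, x)`. -/
def ultraExt {X : Type*} (a : Ultrafilter X → X → ℝ≥0∞)
    (𝔛 : Ultrafilter (Ultrafilter X)) (𝔵 : Ultrafilter X) : ℝ≥0∞ :=
  ⨆ 𝒜 ∈ 𝔛, ⨆ A ∈ 𝔵, ⨅ 𝔞 ∈ 𝒜, ⨅ x ∈ A, a 𝔞 x

/-- A pseudo-approach structure on `X`: a convergence `UX × X → [0,∞]` that is zero at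
`(principal ultrafilter of x, x)`. -/
structure PseudoApproachSpace (X : Type*) where
  conv : Ultrafilter X → X → ℝ≥0∞
  conv_pure : ∀ x, conv (pure x) x = 0

/-- An approach structure on `X`, given by its ultrafilter convergence. -/
structure ApproachSpace (X : Type*) extends PseudoApproachSpace X where
  conv_join : ∀ (𝔛 : Ultrafilter (Ultrafilter X)) (𝔵 : Ultrafilter X) (x : X),
    conv (ultraJoin 𝔛) x ≤ ultraExt conv 𝔛 𝔵 + conv 𝔵 x

/-- Approach maps between (pseudo-)approach spaces. Approach spaces form a full subcategory of
pseudo-approach spaces, so for approach spaces these are the morphisms of `App`. -/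
def IsApproachMap {X Y : Type*} (a : PseudoApproachSpace X) (b : PseudoApproachSpace Y)
    (f : X → Y) : Prop :=
  ∀ (𝔵 : Ultrafilter X) (x : X), b.conv (𝔵.map f) (f x) ≤ a.conv 𝔵 x

/-- The hom-set of approach maps. -/
def ApproachMap {X Y : Type*} (a : PseudoApproachSpace X) (b : PseudoApproachSpace Y) :=
  {f : X → Y // IsApproachMap a b f}

/-- The underlying order: `x ≤ y` iff `a(ẋ, y) = 0`. -/
def PseudoApproachSpace.Le {X : Type*} (a : PseudoApproachSpace X) (x y : X) : Prop :=
  a.conv (pure x) y = 0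

/-- `f ⊣ g` in the ordered category of approach maps. -/
def IsApproachAdjunction {X Y : Type*} (a : PseudoApproachSpace X) (b : PseudoApproachSpace Y)
    (f : X → Y) (g : Y → X) : Prop :=
  IsApproachMap a b f ∧ IsApproachMap b a g ∧
    (∀ x, a.Le x (g (f x))) ∧ (∀ y, b.Le (f (g y)) y)

/-! ### Constructions -/

open Classical in
/-- A topological space as an approach space: convergence is `0` if `𝔵 → x` and `∞` otherwise. -/
def topApproach (I : Type*) [TopologicalSpace I] : PseudoApproachSpace I where
  conv 𝔲 i := if (𝔲 : Filter I) ≤ 𝓝 i then 0 else ∞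
  conv_pure i := by
    have h : ((pure i : Ultrafilter I) : Filter I) ≤ 𝓝 i := by
      rw [Ultrafilter.coe_pure]; exact pure_le_nhds i
    exact if_pos h

/-- The space `X ⊕ Y`, with the sum of the two convergences. -/
def sumApproach {X Y : Type*} (a : PseudoApproachSpace X) (b : PseudoApproachSpace Y) :
    PseudoApproachSpace (X × Y) where
  conv 𝔴 p := a.conv (𝔴.map Prod.fst) p.1 + b.conv (𝔴.map Prod.snd) p.2
  conv_pure p := by
    have h1 : (pure p : Ultrafilter (X × Y)).map Prod.fst = pure p.1 := Ultrafilter.map_pure _ _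
    have h2 : (pure p : Ultrafilter (X × Y)).map Prod.snd = pure p.2 := Ultrafilter.map_pure _ _
    rw [h1, h2, a.conv_pure, b.conv_pure, add_zero]

/-- The function space `Y^X` on the set of approach maps `X → Y`, with
`⟦𝔭, h⟧ = sup { b(U ev 𝔴, h x) ⊖ a(U π₂ 𝔴, x) | x ∈ X, 𝔴 ∈ U(Y^X × X), U π₁ 𝔴 = 𝔭 }`.
If `X` is `+`-exponentiable and `Y` is an approach space, this is the exponential in `App`. -/
def powApproach {X Y : Type*} (a : PseudoApproachSpace X) (b : PseudoApproachSpace Y) :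
    PseudoApproachSpace (ApproachMap a b) where
  conv 𝔭 h := ⨆ (x : X) (𝔴 : Ultrafilter (ApproachMap a b × X)) (_ : 𝔴.map Prod.fst = 𝔭),
    (b.conv (𝔴.map fun q => q.1.1 q.2) (h.1 x) - a.conv (𝔴.map Prod.snd) x)
  conv_pure k := by
    simp only [ENNReal.iSup_eq_zero]
    intro x 𝔴 h𝔴
    have hk : ∀ᶠ q in (𝔴 : Filter (ApproachMap a b × X)), q.1 = k := by
      have : {k} ∈ 𝔴.map Prod.fst := by rw [h𝔴]; exact Set.mem_singleton k
      exact this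
    have he : (𝔴.map fun q => q.1.1 q.2) = (𝔴.map Prod.snd).map k.1 := by
      rw [Ultrafilter.map_map]
      apply Ultrafilter.coe_injective
      rw [Ultrafilter.coe_map, Ultrafilter.coe_map]
      exact Filter.map_congr (hk.mono fun q hq => by simp [hq])
    rw [he]
    exact tsub_eq_zero_of_le (k.2 _ _)

/-- The limit `ξ(𝔳) = sup_{A ∈ 𝔳} inf A` for the Euclidean topology on `[0,∞]`. -/
def xi (𝔳 : Ultrafilter ℝ≥0∞) : ℝ≥0∞ := ⨆ A ∈ 𝔳, sInf A

/-- The approach space `[0,∞]`, with convergence `λ(𝔳, v) = v ⊖ ξ(𝔳)`. -/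
def ennrealApproach : PseudoApproachSpace ℝ≥0∞ where
  conv 𝔳 v := v - xi 𝔳
  conv_pure v := tsub_eq_zero_of_le <|
    le_iSup₂_of_le {v} (show {v} ∈ (pure v : Ultrafilter ℝ≥0∞) from Set.mem_singleton v)
      (by simp)

theorem le_of_xi_lt {Z : Type*} {𝔷 : Ultrafilter Z} {f : Z → ℝ≥0∞} {c : ℝ≥0∞}
    (h : xi (𝔷.map f) < c) : {z | f z < c} ∈ 𝔷 := by
  by_contra hn
  rw [← Ultrafilter.compl_mem_iff_notMem] at hn
  refine absurd h (not_lt.2 ?_)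
  refine le_iSup₂_of_le {v | c ≤ v} ?_ (le_sInf fun _ hv => hv)
  rw [Ultrafilter.mem_map]
  filter_upwards [hn] with z hz
  simpa using hz

namespace ApproachSpace

variable {X : Type u} (a : ApproachSpace X)

/-- The approach distance `δ(x, A) = inf { a(𝔵, x) | A ∈ 𝔵 }`. -/
def dist (x : X) (A : Set X) : ℝ≥0∞ := ⨅ 𝔵 : Ultrafilter X, ⨅ _ : A ∈ 𝔵, a.conv 𝔵 x

/-- The enlargement `A^(ε) = { x | δ(x, A) ≤ ε }`. -/
def enlarge (A : Set X) (ε : ℝ≥0∞) : Set X := {x | a.dist x A ≤ ε}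

/-- The metric on `UX`: `d(𝔵, 𝔶) = inf { ε | ∀ A ∈ 𝔵, A^(ε) ∈ 𝔶 }`. -/
def ultraDist (𝔵 𝔶 : Ultrafilter X) : ℝ≥0∞ :=
  sInf {ε | ∀ A ∈ 𝔵, a.enlarge A ε ∈ 𝔶}

theorem ultraDist_self (𝔵 : Ultrafilter X) : a.ultraDist 𝔵 𝔵 = 0 := by
  refine le_antisymm (sInf_le fun A hA => ?_) bot_le
  filter_upwards [hA] with x hx
  have hx' : A ∈ (pure x : Ultrafilter X) := hx
  change a.dist x A ≤ 0
  exact (iInf₂_le (f := fun (𝔶 : Ultrafilter X) (_ : A ∈ 𝔶) => a.conv 𝔶 x) (pure x) hx').trans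
    (a.conv_pure x).le

/-- The approach space `UX`, induced by the metric `d` and the compact Hausdorff convergence
`m_X`: `(𝔛, 𝔵) ↦ d(m_X 𝔛, 𝔵)`. -/
def ultra : PseudoApproachSpace (Ultrafilter X) where
  conv 𝔛 𝔵 := a.ultraDist (ultraJoin 𝔛) 𝔵
  conv_pure 𝔵 := a.ultraDist_self 𝔵

/-- The dual `(UX)^op`, induced by the dual metric and the same compact Hausdorff convergence:
`(𝔛, 𝔵) ↦ d(𝔵, m_X 𝔛)`. -/
def ultraOp : PseudoApproachSpace (Ultrafilter X) where
  conv 𝔛 𝔵 := a.ultraDist 𝔵 (ultraJoin 𝔛)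
  conv_pure 𝔵 := a.ultraDist_self 𝔵

/-- The points of `PX`: the "down-sets" `ψ : (UX)^op → [0,∞]`. -/
abbrev PSet : Type u := ApproachMap a.ultraOp ennrealApproach

/-- The approach space `PX = [0,∞]^((UX)^op)`. -/
def presheaf : PseudoApproachSpace a.PSet := powApproach a.ultraOp ennrealApproach

/-! ### Basic inequalities, needed to see that certain functions are points of `PX` -/

theorem exists_lift (F : Filter X) (𝔶 : Ultrafilter X) {ε ε' : ℝ≥0∞} (hε : ε < ε')
    (h : ∀ A ∈ F, a.enlarge A ε ∈ 𝔶) :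
    ∃ 𝔛 : Ultrafilter (Ultrafilter X), (∀ A ∈ F, A ∈ ultraJoin 𝔛) ∧
      ultraExt a.conv 𝔛 𝔶 ≤ ε' := by
  let s : Set X × Set X → Set (Ultrafilter X) :=
    fun p => {𝔞 | p.1 ∈ 𝔞 ∧ ∃ y ∈ p.2, a.conv 𝔞 y ≤ ε'}
  let G : Filter (Ultrafilter X) := ⨅ p : {p : Set X × Set X // p.1 ∈ F ∧ p.2 ∈ 𝔶},
    Filter.principal (s p.1)
  have hdir : Directed (· ≥ ·) fun p : {p : Set X × Set X // p.1 ∈ F ∧ p.2 ∈ 𝔶} =>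
      Filter.principal (s p.1) := by
    rintro ⟨⟨A, B⟩, hA, hB⟩ ⟨⟨A', B'⟩, hA', hB'⟩
    refine ⟨⟨(A ∩ A', B ∩ B'), Filter.inter_mem hA hA', Filter.inter_mem hB hB'⟩, ?_, ?_⟩
    · simp only [ge_iff_le, Filter.principal_mono]
      rintro 𝔞 ⟨h1, y, hy, h2⟩
      exact ⟨Filter.mem_of_superset h1 Set.inter_subset_left, y, hy.1, h2⟩
    · simp only [ge_iff_le, Filter.principal_mono]
      rintro 𝔞 ⟨h1, y, hy, h2⟩
      exact ⟨Filter.mem_of_superset h1 Set.inter_subset_right, y, hy.2, h2⟩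
  have : Nonempty {p : Set X × Set X // p.1 ∈ F ∧ p.2 ∈ 𝔶} :=
    ⟨⟨(Set.univ, Set.univ), Filter.univ_mem, Filter.univ_mem⟩⟩
  have : G.NeBot := by
    refine Filter.iInf_neBot_of_directed' hdir ?_
    rintro ⟨⟨A, B⟩, hA, hB⟩
    rw [Filter.principal_neBot_iff]
    obtain ⟨y, hy1, hy2⟩ := 𝔶.nonempty_of_mem (Filter.inter_mem (h A hA) hB)
    have : a.dist y A < ε' := lt_of_le_of_lt hy1 hε
    simp only [dist, iInf_lt_iff] at this
    obtain ⟨𝔞, h1, h2⟩ := this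
    exact ⟨𝔞, h1, y, hy2, h2.le⟩
  have hmem : ∀ A ∈ F, ∀ B ∈ 𝔶, s (A, B) ∈ Ultrafilter.of G := fun A hA B hB =>
    Ultrafilter.of_le G (Filter.mem_iInf_of_mem ⟨(A, B), hA, hB⟩ (Filter.mem_principal_self _))
  refine ⟨Ultrafilter.of G, fun A hA => ?_, ?_⟩
  · rw [mem_ultraJoin]
    exact Filter.mem_of_superset (hmem A hA _ Filter.univ_mem) fun 𝔞 h => h.1
  · refine iSup₂_le fun 𝒜 h𝒜 => iSup₂_le fun B hB => ?_
    obtain ⟨𝔞, h1, -, y, hy, h2⟩ := (Ultrafilter.of G).nonempty_of_mem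
      (Filter.inter_mem h𝒜 (hmem _ Filter.univ_mem B hB))
    exact iInf₂_le_of_le 𝔞 h1 (iInf₂_le_of_le y hy h2)

theorem conv_le_ultraDist_add (𝔵 𝔶 : Ultrafilter X) (x : X) :
    a.conv 𝔵 x ≤ a.ultraDist 𝔵 𝔶 + a.conv 𝔶 x := by
  rw [← tsub_le_iff_right]
  refine le_sInf fun ε hε => le_of_forall_gt fun ε' hlt => ?_
  obtain ⟨ε'', h1, h2⟩ := exists_between hlt
  obtain ⟨𝔛, hm, hU⟩ := a.exists_lift (𝔵 : Filter X) 𝔶 h1 hε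
  have hj : ultraJoin 𝔛 = 𝔵 := Ultrafilter.eq_of_le hm
  refine lt_of_le_of_lt ?_ h2
  rw [tsub_le_iff_right, ← hj]
  exact (a.conv_join 𝔛 𝔶 x).trans (by gcongr)

theorem enlarge_enlarge (A : Set X) (ε ε' : ℝ≥0∞) :
    a.enlarge (a.enlarge A ε) ε' ⊆ a.enlarge A (ε + ε') := by
  intro x hx
  have key : a.dist x A ≤ ε + a.dist x (a.enlarge A ε) := by
    rw [← tsub_le_iff_left]
    refine le_iInf₂ fun 𝔶 h𝔶 => ?_
    rw [tsub_le_iff_left]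
    rw [← tsub_le_iff_right]
    refine le_of_forall_gt fun c hc => ?_
    obtain ⟨c', h1, h2⟩ := exists_between hc
    obtain ⟨𝔛, hm, hU⟩ := a.exists_lift (Filter.principal A) 𝔶 h1 (fun B hB => by
      refine Filter.mem_of_superset h𝔶 fun y (hy : a.dist y A ≤ ε) => ?_
      refine le_trans (b := a.dist y A) ?_ hy
      exact le_iInf₂ fun 𝔵 h𝔵 =>
        iInf₂_le 𝔵 (Filter.mem_of_superset h𝔵 (Filter.mem_principal.1 hB)))
    refine lt_of_le_of_lt ?_ h2
    rw [tsub_le_iff_right]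
    refine (iInf₂_le (ultraJoin 𝔛) (hm A (Filter.mem_principal_self A))).trans ?_
    exact (a.conv_join 𝔛 𝔶 x).trans (by gcongr)
  exact key.trans (by gcongr; exact hx)

theorem enlarge_mono (A : Set X) {ε ε' : ℝ≥0∞} (h : ε ≤ ε') :
    a.enlarge A ε ⊆ a.enlarge A ε' := fun _ hx => le_trans hx h

theorem ultraDist_triangle (𝔵 𝔶 𝔷 : Ultrafilter X) :
    a.ultraDist 𝔵 𝔷 ≤ a.ultraDist 𝔵 𝔶 + a.ultraDist 𝔶 𝔷 := by
  rw [← tsub_le_iff_right]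
  refine le_sInf fun ε hε => ?_
  rw [tsub_le_iff_left, ← tsub_le_iff_right]
  refine le_sInf fun ε' hε' => ?_
  rw [tsub_le_iff_right]
  refine sInf_le fun A hA => ?_
  rw [add_comm]
  exact Filter.mem_of_superset (hε' _ (hε A hA)) (a.enlarge_enlarge A ε ε')

theorem conv_ultraJoin_le (𝔛 : Ultrafilter (Ultrafilter X)) (x : X) :
    a.conv (ultraJoin 𝔛) x ≤ xi (𝔛.map fun 𝔞 => a.conv 𝔞 x) := by
  refine le_of_forall_gt fun c hc => ?_
  obtain ⟨c', h1, h2⟩ := exists_between hc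
  have hs := le_of_xi_lt h1
  refine lt_of_le_of_lt ?_ h2
  refine (a.conv_join 𝔛 (pure x) x).trans ?_
  rw [a.conv_pure, add_zero]
  refine iSup₂_le fun 𝒜 h𝒜 => iSup₂_le fun B hB => ?_
  obtain ⟨𝔞, h3, h4⟩ := 𝔛.nonempty_of_mem (Filter.inter_mem h𝒜 hs)
  exact iInf₂_le_of_le 𝔞 h3 (iInf₂_le_of_le x hB (le_of_lt h4))

/-- A criterion for being a point of `PX`. -/
theorem isApproachMap_of_le {ψ : Ultrafilter X → ℝ≥0∞}
    (h1 : ∀ 𝔵 𝔶, ψ 𝔵 ≤ a.ultraDist 𝔵 𝔶 + ψ 𝔶)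
    (h2 : ∀ 𝔛 : Ultrafilter (Ultrafilter X), ψ (ultraJoin 𝔛) ≤ xi (𝔛.map ψ)) :
    IsApproachMap a.ultraOp ennrealApproach ψ := by
  intro 𝔛 𝔵
  change ψ 𝔵 - xi (𝔛.map ψ) ≤ a.ultraDist 𝔵 (ultraJoin 𝔛)
  rw [tsub_le_iff_right]
  exact (h1 𝔵 (ultraJoin 𝔛)).trans (by gcongr; exact h2 𝔛)

/-! ### Yoneda embeddings and other maps into `PX` -/

/-- The Yoneda embedding `X → PX`, `x ↦ a(-, x)`. -/
def yoneda (x : X) : a.PSet :=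
  ⟨fun 𝔵 => a.conv 𝔵 x, a.isApproachMap_of_le
    (fun 𝔵 𝔶 => a.conv_le_ultraDist_add 𝔵 𝔶 x) fun 𝔛 => a.conv_ultraJoin_le 𝔛 x⟩

/-- The map `X ⊕ [0,∞] → PX`, `(x, u) ↦ a(-, x) + u`. -/
def formalBall (p : X × ℝ≥0∞) : a.PSet :=
  ⟨fun 𝔵 => a.conv 𝔵 p.1 + p.2, a.isApproachMap_of_le
    (fun 𝔵 𝔶 => by
      rw [← add_assoc]; gcongr; exact a.conv_le_ultraDist_add 𝔵 𝔶 p.1)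
    fun 𝔛 => by
      refine le_of_forall_gt fun c hc => ?_
      obtain ⟨c', h1, h2⟩ := exists_between hc
      have hs := le_of_xi_lt h1
      refine lt_of_le_of_lt ?_ h2
      obtain ⟨𝔞, h𝔞⟩ := 𝔛.nonempty_of_mem hs
      have hu : p.2 ≤ c' := le_trans le_add_self (le_of_lt h𝔞)
      have hx : a.conv (ultraJoin 𝔛) p.1 ≤ c' - p.2 := by
        refine (a.conv_join 𝔛 (pure p.1) p.1).trans ?_
        rw [a.conv_pure, add_zero]
        refine iSup₂_le fun 𝒜 h𝒜 => iSup₂_le fun B hB => ?_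
        obtain ⟨𝔟, h3, h4⟩ := 𝔛.nonempty_of_mem (Filter.inter_mem h𝒜 hs)
        refine iInf₂_le_of_le 𝔟 h3 (iInf₂_le_of_le p.1 hB ?_)
        have h4' : a.conv 𝔟 p.1 + p.2 < c' := h4
        have hne : p.2 ≠ ∞ := fun ht => by simp [ht] at h4'
        exact ENNReal.le_sub_of_add_le_right hne h4'.le
      calc a.conv (ultraJoin 𝔛) p.1 + p.2 ≤ (c' - p.2) + p.2 := by gcongr
        _ = c' := tsub_add_cancel_of_le hu⟩

/-- The "second" Yoneda embedding `UX → PX`, `𝔵 ↦ d(-, 𝔵)`. -/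
def ultraYoneda (𝔵 : Ultrafilter X) : a.PSet :=
  ⟨fun 𝔶 => a.ultraDist 𝔶 𝔵, a.isApproachMap_of_le
    (fun 𝔶 𝔷 => a.ultraDist_triangle 𝔶 𝔷 𝔵)
    fun 𝔛 => by
      refine le_of_forall_gt fun c hc => ?_
      obtain ⟨c', h1, h2⟩ := exists_between hc
      refine lt_of_le_of_lt (sInf_le fun A hA => ?_) h2
      obtain ⟨𝔞, h3, h4⟩ := 𝔛.nonempty_of_mem
        (Filter.inter_mem (mem_ultraJoin.1 hA) (le_of_xi_lt h1))
      obtain ⟨ε, hε, hlt⟩ := sInf_lt_iff.1 (show sInf _ < c' from h4)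
      exact Filter.mem_of_superset (hε A h3) (a.enlarge_mono A hlt.le)⟩

/-- The points of `X^I`: the approach maps from the topological space `I` to `X`. -/
abbrev PowSet (I : Type*) [TopologicalSpace I] :=
  ApproachMap (topApproach I) a.toPseudoApproachSpace

/-- The map `X^I → PX`, `φ ↦ inf_{i ∈ I} a(-, φ i)`, for a compact (Hausdorff) space `I`. -/
def family (I : Type*) [TopologicalSpace I] [CompactSpace I] (φ : a.PowSet I) : a.PSet :=
  ⟨fun 𝔵 => ⨅ i, a.conv 𝔵 (φ.1 i), a.isApproachMap_of_le
    (fun 𝔵 𝔶 => by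
      rw [← tsub_le_iff_left]
      refine le_iInf fun i => ?_
      rw [tsub_le_iff_left]
      exact (iInf_le _ i).trans (a.conv_le_ultraDist_add 𝔵 𝔶 _))
    fun 𝔛 => by
      classical
      refine le_of_forall_gt fun c hc => ?_
      obtain ⟨c', h1, h2⟩ := exists_between hc
      have hs := le_of_xi_lt h1
      refine lt_of_le_of_lt ?_ h2
      have hex : ∀ 𝔞 ∈ {𝔞 : Ultrafilter X | ⨅ i, a.conv 𝔞 (φ.1 i) < c'},
          ∃ i, a.conv 𝔞 (φ.1 i) < c' := fun 𝔞 h => iInf_lt_iff.1 h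
      obtain ⟨𝔞₀, h𝔞₀⟩ := 𝔛.nonempty_of_mem hs
      obtain ⟨i₀, -⟩ := hex 𝔞₀ h𝔞₀
      have : Nonempty I := ⟨i₀⟩
      choose! t ht using hex
      have hlim : (topApproach I).conv (𝔛.map t) (𝔛.map t).lim = 0 := by
        have := (𝔛.map t).le_nhds_lim
        exact if_pos this
      refine (iInf_le _ (𝔛.map t).lim).trans ?_
      refine (a.conv_join 𝔛 ((𝔛.map t).map φ.1) _).trans ?_
      have h0 := φ.2 (𝔛.map t) (𝔛.map t).lim
      rw [hlim] at h0
      rw [nonpos_iff_eq_zero.1 h0, add_zero]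
      refine iSup₂_le fun 𝒜 h𝒜 => iSup₂_le fun B hB => ?_
      obtain ⟨𝔞, ⟨h3, h4⟩, h5⟩ := 𝔛.nonempty_of_mem
        (Filter.inter_mem (Filter.inter_mem h𝒜 hs)
          (show {𝔞 | φ.1 (t 𝔞) ∈ B} ∈ 𝔛 from hB))
      exact iInf₂_le_of_le 𝔞 h3 (iInf₂_le_of_le _ h5 (ht 𝔞 h4).le)⟩

/-! ### Cocompleteness -/

/-- `x₀` is a supremum of the down-set `ψ`. -/
def IsSupremum (ψ : a.PSet) (x₀ : X) : Prop :=
  ∀ x, a.conv (pure x₀) x = ⨆ 𝔵 : Ultrafilter X, (a.conv 𝔵 x - ψ.1 𝔵)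

/-- Every down-set `ψ : (UX)^op → [0,∞]` has a supremum in `X`. -/
def Cocomplete : Prop := ∀ ψ : a.PSet, ∃ x₀, a.IsSupremum ψ x₀

/-- The Yoneda embedding `X → PX` has a left adjoint in `App`. -/
def AbsolutelyCocomplete : Prop :=
  ∃ L : a.PSet → X,
    IsApproachAdjunction a.presheaf a.toPseudoApproachSpace L a.yoneda

/-- `S` is a choice of the map `Sup_X : PX → X` (suprema are unique up to equivalence). -/
def IsSupMap (S : a.PSet → X) : Prop := ∀ ψ, a.IsSupremum ψ (S ψ)

end ApproachSpace

end

/-!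
The convergence of `PX` at `ψ` is tested on ultrafilters of pairs:
`𝔭 → ψ` within `e` iff `ψ (lim 𝔶) ≤ lim φ(𝔶) + e` for all ultrafilters of pairs `(φ, 𝔶)` over `𝔭`
(`le_xi_add_presheaf_conv`, `presheaf_conv_map_le`).

If the Yoneda embedding has a left adjoint, its values are suprema, so every choice of suprema is
equivalent to it and is an approach map `PX → X`. The three maps of the statement are its
composites with approach maps `X ⊕ [0,∞] → PX`, `UX → PX` and `X^I → PX`.

For the converse one has to show that `Sup : PX → X` is an approach map. Let `𝔭` be an ultrafilter
on `PX` and let `c` exceed the distance of `𝔭` to `ψ`. By compactness of `UX`, the epigraphs of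
`𝔭`-most `φ` lie in any given neighbourhood of the epigraph of `ψ ⊖ c`
(`eventually_forall_exists_mem_iff`); a basis of neighbourhoods is indexed by pairs `j = (F, N)`,
where the finite set `F` of subsets of `X` says which ultrafilters are close and `N` truncates at
height `N`. It is therefore enough to move along `j` instead of along `𝔭`. Each neighbourhood is
parametrized by a single compact Hausdorff space, `I = U(UX × UX)`: the family `Φ j : I → X` extends
`(𝔶, 𝔵) ↦ α(𝔶) + min (ψ 𝔵 ⊖ c) N` if `𝔶` and `𝔵` agree on `F`, and
`(𝔶, 𝔵) ↦ α(𝔵) + min (ψ 𝔵 ⊖ c) N` otherwise. These families converge uniformly to the extension of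
`(𝔶, 𝔵) ↦ α(𝔵) + (ψ 𝔵 ⊖ c)`, so continuity of `⋁ : X^I → X` transports the convergence to
suprema. That the families are continuous is the continuity of `+` and `α` (`shiftFamily`).
-/

open Filter

/-! ### Limits in `[0,∞]` along ultrafilters -/

theorem le_xi_map {Z : Type*} {𝔷 : Ultrafilter Z} {f : Z → ℝ≥0∞} {c : ℝ≥0∞}
    (h : ∀ᶠ z in (𝔷 : Filter Z), c ≤ f z) : c ≤ xi (𝔷.map f) :=
  le_iSup₂_of_le (Set.Ici c) (show Set.Ici c ∈ 𝔷.map f from h) (le_sInf fun _ hv => hv)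

theorem xi_map_le {Z : Type*} {𝔷 : Ultrafilter Z} {f : Z → ℝ≥0∞} {c : ℝ≥0∞}
    (h : ∀ᶠ z in (𝔷 : Filter Z), f z ≤ c) : xi (𝔷.map f) ≤ c := by
  refine iSup₂_le fun A hA => ?_
  obtain ⟨z, h1, h2⟩ := 𝔷.nonempty_of_mem (Filter.inter_mem (Ultrafilter.mem_map.1 hA) h)
  exact (sInf_le (show f z ∈ A from h1)).trans h2

theorem eventually_lt_of_lt_xi {Z : Type*} {𝔷 : Ultrafilter Z} {f : Z → ℝ≥0∞} {c : ℝ≥0∞}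
    (h : c < xi (𝔷.map f)) : ∀ᶠ z in (𝔷 : Filter Z), c < f z := by
  by_contra hn
  refine absurd h (not_lt.2 (xi_map_le ?_))
  exact (Ultrafilter.eventually_not.2 hn).mono fun z (hz : ¬c < f z) => not_lt.1 hz

theorem xi_pure (v : ℝ≥0∞) : xi (pure v) = v := by
  have h : (pure v : Ultrafilter ℝ≥0∞) = (pure v : Ultrafilter ℝ≥0∞).map id := by simp
  rw [h]
  exact le_antisymm (xi_map_le (by simp)) (le_xi_map (by simp))

theorem xi_map_add_le {Z : Type*} (𝔷 : Ultrafilter Z) (f g : Z → ℝ≥0∞) :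
    xi (𝔷.map f) + xi (𝔷.map g) ≤ xi (𝔷.map fun z => f z + g z) := by
  refine ENNReal.biSup_add_biSup_le' ⟨Set.univ, Filter.univ_mem⟩ ⟨Set.univ, Filter.univ_mem⟩
    fun A hA B hB => le_xi_map ?_
  filter_upwards [Ultrafilter.mem_map.1 hA, Ultrafilter.mem_map.1 hB] with z h1 h2
  exact add_le_add (sInf_le h1) (sInf_le h2)

theorem xi_map_le_xi_map_sub_add {Z : Type*} (𝔷 : Ultrafilter Z) (f : Z → ℝ≥0∞) (c : ℝ≥0∞) :
    xi (𝔷.map f) ≤ xi (𝔷.map fun z => f z - c) + c := by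
  rw [← tsub_le_iff_right]
  refine le_of_forall_lt fun t ht => ?_
  obtain ⟨t', h1, h2⟩ := exists_between ht
  refine h1.trans_le (le_xi_map ?_)
  exact (eventually_lt_of_lt_xi (lt_tsub_iff_right.1 h2)).mono fun z hz =>
    (lt_tsub_iff_right.2 hz).le

/-! ### Ultrafilters of ultrafilters and of pairs -/

theorem mem_ultraJoin_map {X W : Type*} {𝔴 : Ultrafilter W} {g : W → Ultrafilter X} {A : Set X} :
    A ∈ ultraJoin (𝔴.map g) ↔ ∀ᶠ w in (𝔴 : Filter W), A ∈ g w := Iff.rfl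

theorem ultraJoin_pure {X : Type*} (𝔵 : Ultrafilter X) : ultraJoin (pure 𝔵) = 𝔵 :=
  Ultrafilter.ext fun _ => Iff.rfl

/-- Ultrafilters lift along the weak pullback `W × Z → Y × Z`: an ultrafilter on `Y × Z` whose
first projection is the image of `𝔳` comes from an ultrafilter on `W × Z` over `𝔳`. -/
theorem exists_ultrafilter_prod_lift {W Y Z : Type*} (g : W → Y) (𝔳 : Ultrafilter W)
    (𝔴 : Ultrafilter (Y × Z)) (h : 𝔴.map Prod.fst = 𝔳.map g) :
    ∃ 𝔴' : Ultrafilter (W × Z), 𝔴'.map Prod.fst = 𝔳 ∧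
      𝔴'.map (fun q => (g q.1, q.2)) = 𝔴 := by
  let G : Filter (W × Z) := comap Prod.fst (𝔳 : Filter W) ⊓
    comap (fun q => (g q.1, q.2)) (𝔴 : Filter (Y × Z))
  have hne : NeBot G := by
    rw [Filter.inf_neBot_iff]
    rintro s ⟨A, hA, hs⟩ t ⟨B, hB, ht⟩
    have h1 : g '' A ∈ 𝔴.map Prod.fst := by
      rw [h]
      exact Filter.image_mem_map hA
    obtain ⟨⟨y, z⟩, ⟨w, hw, rfl⟩, hy⟩ :=
      𝔴.nonempty_of_mem (Filter.inter_mem (Ultrafilter.mem_map.1 h1) hB)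
    exact ⟨(w, z), hs hw, ht hy⟩
  refine ⟨Ultrafilter.of G, ?_, ?_⟩
  · exact Ultrafilter.eq_of_le (Filter.map_le_iff_le_comap.2
      ((Ultrafilter.of_le _).trans inf_le_left))
  · exact Ultrafilter.eq_of_le (Filter.map_le_iff_le_comap.2
      ((Ultrafilter.of_le _).trans inf_le_right))

/-! ### Approach maps -/

theorem IsApproachMap.comp {X Y Z : Type*} {a : PseudoApproachSpace X} {b : PseudoApproachSpace Y}
    {c : PseudoApproachSpace Z} {g : Y → Z} {f : X → Y} (hg : IsApproachMap b c g)
    (hf : IsApproachMap a b f) : IsApproachMap a c (fun x => g (f x)) := fun 𝔵 x => by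
  have h := hg (𝔵.map f) (f x)
  rw [Ultrafilter.map_map] at h
  exact h.trans (hf 𝔵 x)

theorem topApproach_conv_of_le {I : Type*} [TopologicalSpace I] {𝔲 : Ultrafilter I} {i : I}
    (h : (𝔲 : Filter I) ≤ 𝓝 i) : (topApproach I).conv 𝔲 i = 0 := if_pos h

theorem topApproach_conv_of_not_le {I : Type*} [TopologicalSpace I] {𝔲 : Ultrafilter I} {i : I}
    (h : ¬(𝔲 : Filter I) ≤ 𝓝 i) : (topApproach I).conv 𝔲 i = ∞ := if_neg h

/-- The convergence of `Y^I` for a topological space `I` only involves limits in `I`; the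
functions may be indexed by a set `W` carrying an ultrafilter. -/
theorem powApproach_topApproach_conv_eq_zero {I Y W : Type*} [TopologicalSpace I]
    {b : PseudoApproachSpace Y} (g : W → ApproachMap (topApproach I) b) (𝔳 : Ultrafilter W)
    (h : ApproachMap (topApproach I) b)
    (H : ∀ (𝔴 : Ultrafilter (W × I)) (i : I), 𝔴.map Prod.fst = 𝔳 →
      Tendsto Prod.snd (𝔴 : Filter (W × I)) (𝓝 i) →
      b.conv (𝔴.map fun q => (g q.1).1 q.2) (h.1 i) = 0) :
    (powApproach (topApproach I) b).conv (𝔳.map g) h = 0 := by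
  refine le_antisymm (iSup_le fun i => iSup₂_le fun 𝔴 h𝔴 => ?_) bot_le
  obtain ⟨𝔴', h1, rfl⟩ := exists_ultrafilter_prod_lift g 𝔳 𝔴 h𝔴
  by_cases hi : Tendsto Prod.snd (𝔴' : Filter (W × I)) (𝓝 i)
  · rw [Ultrafilter.map_map]
    exact tsub_le_iff_right.2 ((H 𝔴' i h1 hi).le.trans bot_le)
  · rw [Ultrafilter.map_map, topApproach_conv_of_not_le (by exact hi)]
    simp

namespace ApproachSpace

variable {X : Type u} (a : ApproachSpace X)

/-- The transitivity axiom along an ultrafilter of pairs `(g w, f w)`, with `Ua` replaced by a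
limit. -/
theorem conv_join_map_le {W : Type*} (𝔴 : Ultrafilter W) (g : W → Ultrafilter X) (f : W → X)
    (x : X) : a.conv (ultraJoin (𝔴.map g)) x ≤
      xi (𝔴.map fun w => a.conv (g w) (f w)) + a.conv (𝔴.map f) x := by
  refine (a.conv_join (𝔴.map g) (𝔴.map f) x).trans (add_le_add_left ?_ _)
  refine iSup₂_le fun 𝒜 h𝒜 => iSup₂_le fun A hA => le_xi_map ?_
  filter_upwards [Ultrafilter.mem_map.1 h𝒜, Ultrafilter.mem_map.1 hA] with w h1 h2
  exact iInf₂_le_of_le (g w) h1 (iInf₂_le (f w) h2)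

theorem conv_triangle (𝔵 : Ultrafilter X) (x y : X) :
    a.conv 𝔵 y ≤ a.conv 𝔵 x + a.conv (pure x) y := by
  have h := a.conv_join_map_le (pure () : Ultrafilter Unit) (fun _ => 𝔵) (fun _ => x) y
  simpa only [Ultrafilter.map_pure, xi_pure, ultraJoin_pure] using h

theorem dist_le_of_mem {A : Set X} {x y : X} (hx : x ∈ A) : a.dist y A ≤ a.conv (pure x) y :=
  iInf₂_le (f := fun (𝔶 : Ultrafilter X) (_ : A ∈ 𝔶) => a.conv 𝔶 y) (pure x)
    (show A ∈ (pure x : Ultrafilter X) from hx)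

/-- The quantifiers are not uniform: for each `w`, the set of `v` with `f v ≤ g w` may depend
on `w`. -/
theorem ultraDist_map_map_eq_zero {V W : Type*} {𝔳 : Ultrafilter V} {𝔴 : Ultrafilter W}
    {f : V → X} {g : W → X}
    (h : ∀ᶠ w in (𝔴 : Filter W), ∀ᶠ v in (𝔳 : Filter V), a.Le (f v) (g w)) :
    a.ultraDist (𝔳.map f) (𝔴.map g) = 0 := by
  refine le_antisymm (sInf_le fun A hA => ?_) bot_le
  refine Ultrafilter.mem_map.2 ?_
  filter_upwards [h] with w hw
  obtain ⟨v, h1, h2⟩ := (hw.and (Ultrafilter.mem_map.1 hA)).exists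
  exact (a.dist_le_of_mem h2).trans (le_of_eq h1)

/-! ### Convergence in `PX` -/

theorem PSet.le_ultraDist_add {a : ApproachSpace X} (ψ : a.PSet) (𝔵 𝔶 : Ultrafilter X) :
    ψ.1 𝔵 ≤ a.ultraDist 𝔵 𝔶 + ψ.1 𝔶 := by
  have h := ψ.2 (pure 𝔶) 𝔵
  rw [Ultrafilter.map_pure] at h
  change ψ.1 𝔵 - xi (pure (ψ.1 𝔶)) ≤ a.ultraDist 𝔵 (ultraJoin (pure 𝔶)) at h
  rwa [xi_pure, ultraJoin_pure, tsub_le_iff_right] at h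

/-- Points of `PX` are lower semicontinuous on the compact space `UX`. -/
theorem PSet.ultraJoin_le {a : ApproachSpace X} (ψ : a.PSet) (𝔛 : Ultrafilter (Ultrafilter X)) :
    ψ.1 (ultraJoin 𝔛) ≤ xi (𝔛.map ψ.1) := by
  have h := ψ.2 𝔛 (ultraJoin 𝔛)
  change ψ.1 (ultraJoin 𝔛) - xi (𝔛.map ψ.1) ≤ a.ultraDist (ultraJoin 𝔛) (ultraJoin 𝔛) at h
  rwa [a.ultraDist_self, tsub_le_iff_right, zero_add] at h

/-- The term of the supremum defining the convergence of `PX` at the limit point `m_X(Uk(𝔴))`,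
where the metric correction vanishes. -/
theorem le_xi_add_presheaf_conv {W : Type*} (𝔴 : Ultrafilter W) (g : W → a.PSet)
    (k : W → Ultrafilter X) (ψ : a.PSet) :
    ψ.1 (ultraJoin (𝔴.map k)) ≤
      xi (𝔴.map fun w => (g w).1 (k w)) + a.presheaf.conv (𝔴.map g) ψ := by
  rw [← tsub_le_iff_left]
  refine le_iSup_of_le (ultraJoin (𝔴.map k)) (le_iSup₂_of_le (𝔴.map fun w => (g w, k w)) ?_ ?_)
  · rw [Ultrafilter.map_map]; rfl
  · simp only [Ultrafilter.map_map]
    change _ ≤ ψ.1 _ - xi _ - a.ultraDist (ultraJoin (𝔴.map k)) (ultraJoin (𝔴.map k))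
    rw [a.ultraDist_self, tsub_zero]
    exact le_rfl

/-- It suffices to test convergence in `PX` at limit points, since `ψ` is nonexpansive for the
metric of `UX`. -/
theorem presheaf_conv_map_le {W : Type*} (𝔳 : Ultrafilter W) (g : W → a.PSet) (ψ : a.PSet)
    {c : ℝ≥0∞}
    (H : ∀ 𝔴 : Ultrafilter (W × Ultrafilter X), 𝔴.map Prod.fst = 𝔳 →
      ψ.1 (ultraJoin (𝔴.map Prod.snd)) ≤ xi (𝔴.map fun q => (g q.1).1 q.2) + c) :
    a.presheaf.conv (𝔳.map g) ψ ≤ c := by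
  refine iSup_le fun 𝔵 => iSup₂_le fun 𝔴 h𝔴 => ?_
  obtain ⟨𝔴', h1, rfl⟩ := exists_ultrafilter_prod_lift g 𝔳 𝔴 h𝔴
  simp only [Ultrafilter.map_map]
  change ψ.1 𝔵 - xi (𝔴'.map fun q => (g q.1).1 q.2) -
    a.ultraDist 𝔵 (ultraJoin (𝔴'.map Prod.snd)) ≤ c
  rw [tsub_le_iff_left, tsub_le_iff_left]
  calc ψ.1 𝔵 ≤ _ := ψ.le_ultraDist_add 𝔵 (ultraJoin (𝔴'.map Prod.snd))
    _ ≤ _ := add_le_add_right (H 𝔴' h1) _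
    _ = _ := by ring

theorem presheaf_conv_pure (φ ψ : a.PSet) :
    a.presheaf.conv (pure φ) ψ = ⨆ 𝔵 : Ultrafilter X, (ψ.1 𝔵 - φ.1 𝔵) := by
  refine le_antisymm ?_ (iSup_le fun 𝔵 => ?_)
  · have h := a.presheaf_conv_map_le (pure () : Ultrafilter Unit) (fun _ => φ) ψ
      (c := ⨆ 𝔵 : Ultrafilter X, (ψ.1 𝔵 - φ.1 𝔵)) fun 𝔴 _ => ?_
    · rwa [Ultrafilter.map_pure] at h
    · have h1 := φ.ultraJoin_le (𝔴.map Prod.snd)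
      rw [Ultrafilter.map_map] at h1
      refine le_trans ?_ (add_le_add_left h1 _)
      rw [← tsub_le_iff_left]
      exact le_iSup (fun 𝔵 => ψ.1 𝔵 - φ.1 𝔵) _
  · have h := a.le_xi_add_presheaf_conv (pure () : Ultrafilter Unit) (fun _ => φ) (fun _ => 𝔵) ψ
    rw [Ultrafilter.map_pure, Ultrafilter.map_pure, Ultrafilter.map_pure, xi_pure,
      ultraJoin_pure] at h
    exact tsub_le_iff_left.2 h

/-! ### The canonical maps into `PX` are approach maps -/

theorem isApproachMap_formalBall :
    IsApproachMap (sumApproach a.toPseudoApproachSpace ennrealApproach) a.presheaf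
      a.formalBall := by
  rintro 𝔳 ⟨x, u⟩
  refine a.presheaf_conv_map_le 𝔳 _ _ fun 𝔴 h𝔴 => ?_
  subst h𝔴
  simp only [sumApproach, Ultrafilter.map_map]
  have h1 := a.conv_join_map_le 𝔴 Prod.snd (fun q => q.1.1) x
  have h2 := xi_map_add_le 𝔴 (fun q => a.conv q.2 q.1.1) (fun q => q.1.2)
  have h3 : u ≤ xi (𝔴.map fun q => q.1.2) + (u - xi (𝔴.map fun q => q.1.2)) := le_add_tsub
  calc a.conv (ultraJoin (𝔴.map Prod.snd)) x + u ≤ _ := add_le_add h1 h3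
    _ = (xi (𝔴.map fun q => a.conv q.2 q.1.1) + xi (𝔴.map fun q => q.1.2)) +
        (a.conv (𝔴.map fun q => q.1.1) x + (u - xi (𝔴.map fun q => q.1.2))) := by ring
    _ ≤ _ := add_le_add_left h2 _

theorem isApproachMap_yoneda :
    IsApproachMap a.toPseudoApproachSpace a.presheaf a.yoneda := by
  intro 𝔵 x
  refine a.presheaf_conv_map_le 𝔵 _ _ fun 𝔴 h𝔴 => ?_
  subst h𝔴
  exact a.conv_join_map_le 𝔴 Prod.snd Prod.fst x

theorem ultraDist_join_join_le {W : Type*} (𝔴 : Ultrafilter W) (f g : W → Ultrafilter X) :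
    a.ultraDist (ultraJoin (𝔴.map f)) (ultraJoin (𝔴.map g)) ≤
      xi (𝔴.map fun w => a.ultraDist (f w) (g w)) := by
  refine le_of_forall_gt fun c hc => ?_
  obtain ⟨c', h1, h2⟩ := exists_between hc
  refine lt_of_le_of_lt (sInf_le fun A hA => mem_ultraJoin_map.2 ?_) h2
  filter_upwards [mem_ultraJoin_map.1 hA, le_of_xi_lt h1] with w h3 h4
  obtain ⟨ε, hε, hlt⟩ := sInf_lt_iff.1 (show sInf _ < c' from h4)
  exact Filter.mem_of_superset (hε A h3) (a.enlarge_mono A hlt.le)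

theorem isApproachMap_ultraYoneda : IsApproachMap a.ultra a.presheaf a.ultraYoneda := by
  intro 𝔛 𝔵
  refine a.presheaf_conv_map_le 𝔛 _ _ fun 𝔴 h𝔴 => ?_
  subst h𝔴
  exact (a.ultraDist_triangle _ (ultraJoin (𝔴.map Prod.fst)) 𝔵).trans
    (add_le_add_left (a.ultraDist_join_join_le 𝔴 Prod.snd Prod.fst) _)

theorem isApproachMap_family (I : Type*) [TopologicalSpace I] [CompactSpace I] :
    IsApproachMap (powApproach (topApproach I) a.toPseudoApproachSpace) a.presheaf
      (a.family I) := by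
  intro 𝔭 h
  refine a.presheaf_conv_map_le 𝔭 _ _ fun 𝔴 h𝔴 => ?_
  subst h𝔴
  rw [← tsub_le_iff_right]
  refine le_of_forall_gt fun c hc => ?_
  obtain ⟨c', h1, h2⟩ := exists_between hc
  have hs := le_of_xi_lt h1
  have hex : ∀ q ∈ {q : a.PowSet I × Ultrafilter X | (a.family I q.1).1 q.2 < c'},
      ∃ i, a.conv q.2 (q.1.1 i) < c' := fun q hq => iInf_lt_iff.1 hq
  obtain ⟨q₀, hq₀⟩ := 𝔴.nonempty_of_mem hs
  obtain ⟨i₀, -⟩ := hex q₀ hq₀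
  have : Nonempty I := ⟨i₀⟩
  choose! t ht using hex
  refine lt_of_le_of_lt ?_ h2
  rw [tsub_le_iff_right]
  -- The indices almost attaining the infima converge by compactness; their limit is a witness.
  refine (iInf_le _ (𝔴.map t).lim).trans ((a.conv_join_map_le 𝔴 Prod.snd
    (fun q => q.1.1 (t q)) _).trans (add_le_add (xi_map_le ?_) ?_))
  · filter_upwards [hs] with q hq using (ht q hq).le
  · refine le_iSup_of_le (𝔴.map t).lim (le_iSup₂_of_le (𝔴.map fun q => (q.1, t q)) ?_ ?_)
    · rw [Ultrafilter.map_map]; rfl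
    · simp only [Ultrafilter.map_map]
      have h0 : (topApproach I).conv (𝔴.map t) (𝔴.map t).lim = 0 :=
        topApproach_conv_of_le (𝔴.map t).le_nhds_lim
      change _ ≤ _ - (topApproach I).conv (𝔴.map t) _
      rw [h0, tsub_zero]
      exact le_rfl

/-! ### Suprema -/

section IsSupremum

variable {a}

theorem IsSupremum.conv_le {ψ : a.PSet} {x₀ : X} (h : a.IsSupremum ψ x₀) (𝔵 : Ultrafilter X) :
    a.conv 𝔵 x₀ ≤ ψ.1 𝔵 := by
  have h0 := h x₀
  rw [a.conv_pure] at h0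
  exact tsub_eq_zero_iff_le.1 (ENNReal.iSup_eq_zero.1 h0.symm 𝔵)

theorem IsSupremum.conv_pure_le {ψ : a.PSet} {x₀ : X} (h : a.IsSupremum ψ x₀) {y : X} {c : ℝ≥0∞}
    (H : ∀ 𝔵, a.conv 𝔵 y ≤ ψ.1 𝔵 + c) : a.conv (pure x₀) y ≤ c := by
  rw [h y]
  exact iSup_le fun 𝔵 => tsub_le_iff_left.2 (H 𝔵)

theorem IsSupremum.le {ψ : a.PSet} {x₀ : X} (h : a.IsSupremum ψ x₀) {y : X}
    (H : ∀ 𝔵, a.conv 𝔵 y ≤ ψ.1 𝔵) : a.Le x₀ y :=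
  nonpos_iff_eq_zero.1 (h.conv_pure_le (by simpa using H))

theorem IsSupremum.le_of_isSupremum {ψ : a.PSet} {x₀ x₁ : X} (h₀ : a.IsSupremum ψ x₀)
    (h₁ : a.IsSupremum ψ x₁) : a.Le x₀ x₁ :=
  h₀.le h₁.conv_le

end IsSupremum

/-- The values of a left adjoint of the Yoneda embedding are suprema. -/
theorem isSupremum_of_isApproachAdjunction {L : a.PSet → X}
    (hL : IsApproachAdjunction a.presheaf a.toPseudoApproachSpace L a.yoneda) :
    a.IsSupMap L := by
  obtain ⟨h1, h2, h3, h4⟩ := hL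
  intro ψ x
  refine le_antisymm ?_ (iSup_le fun 𝔵 => ?_)
  · have h5 := h1 (pure ψ) (a.yoneda x)
    rw [Ultrafilter.map_pure, presheaf_conv_pure] at h5
    calc a.conv (pure (L ψ)) x ≤ _ := a.conv_triangle _ (L (a.yoneda x)) x
      _ = a.conv (pure (L ψ)) (L (a.yoneda x)) := by
        rw [show a.conv (pure (L (a.yoneda x))) x = 0 from h4 x, add_zero]
      _ ≤ _ := h5
  · have h5 := h3 ψ
    change a.presheaf.conv _ _ = 0 at h5
    rw [presheaf_conv_pure, ENNReal.iSup_eq_zero] at h5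
    have h6 : a.conv 𝔵 (L ψ) ≤ ψ.1 𝔵 := tsub_eq_zero_iff_le.1 (h5 𝔵)
    rw [tsub_le_iff_left]
    exact (a.conv_triangle 𝔵 (L ψ) x).trans (add_le_add_left h6 _)

theorem IsSupMap.isApproachMap_of_isApproachMap {a : ApproachSpace X} {S L : a.PSet → X}
    (hS : a.IsSupMap S) (hL : a.IsSupMap L)
    (h : IsApproachMap a.presheaf a.toPseudoApproachSpace L) :
    IsApproachMap a.presheaf a.toPseudoApproachSpace S := by
  intro 𝔭 ψ
  have h1 : a.conv (𝔭.map S) (L ψ) ≤ a.conv (𝔭.map L) (L ψ) := by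
    have h2 := a.conv_join_map_le 𝔭 (fun φ => pure (S φ)) L (L ψ)
    have h3 : ultraJoin (𝔭.map fun φ => (pure (S φ) : Ultrafilter X)) = 𝔭.map S :=
      Ultrafilter.ext fun _ => Iff.rfl
    rw [h3] at h2
    refine h2.trans (le_of_eq ?_)
    rw [nonpos_iff_eq_zero.1 (xi_map_le (c := 0) (.of_forall fun φ =>
      ((hS φ).le_of_isSupremum (hL φ)).le)), zero_add]
  calc a.conv (𝔭.map S) (S ψ) ≤ _ := a.conv_triangle _ (L ψ) (S ψ)
    _ = a.conv (𝔭.map S) (L ψ) := by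
      rw [show a.conv (pure (L ψ)) (S ψ) = 0 from (hL ψ).le_of_isSupremum (hS ψ), add_zero]
    _ ≤ _ := h1.trans (h 𝔭 ψ)

theorem IsSupMap.isApproachAdjunction {a : ApproachSpace X} {S : a.PSet → X} (hS : a.IsSupMap S)
    (h : IsApproachMap a.presheaf a.toPseudoApproachSpace S) :
    IsApproachAdjunction a.presheaf a.toPseudoApproachSpace S a.yoneda := by
  refine ⟨h, a.isApproachMap_yoneda, fun ψ => ?_, fun x => (hS _).le fun 𝔵 => le_rfl⟩
  change a.presheaf.conv _ _ = 0
  rw [presheaf_conv_pure, ENNReal.iSup_eq_zero]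
  exact fun 𝔵 => tsub_eq_zero_of_le ((hS ψ).conv_le 𝔵)

/-! ### Continuity of the supremum map -/

section Reconstruction

variable {a} {S : a.PSet → X}

/-- The point `α(𝔵) + u` of `X`. -/
noncomputable def shift (S : a.PSet → X) (𝔵 : Ultrafilter X) (u : ℝ≥0∞) : X :=
  S (a.formalBall (S (a.ultraYoneda 𝔵), u))

theorem IsSupMap.conv_shift_le (hS : a.IsSupMap S) (𝔵 : Ultrafilter X) (u : ℝ≥0∞) :
    a.conv 𝔵 (shift S 𝔵 u) ≤ u := by
  refine ((hS _).conv_le 𝔵).trans ?_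
  have h : a.conv 𝔵 (S (a.ultraYoneda 𝔵)) ≤ 0 :=
    ((hS (a.ultraYoneda 𝔵)).conv_le 𝔵).trans (a.ultraDist_self 𝔵).le
  calc a.conv 𝔵 (S (a.ultraYoneda 𝔵)) + u ≤ 0 + u := add_le_add_left h _
    _ = u := zero_add u

/-- The point `α(𝔵) + u` is at distance at most `a(𝔵, y) ⊖ u` from `y`. -/
theorem IsSupMap.conv_pure_shift_le (hS : a.IsSupMap S) {𝔵 : Ultrafilter X} {u c : ℝ≥0∞} {y : X}
    (h : a.conv 𝔵 y ≤ u + c) : a.conv (pure (shift S 𝔵 u)) y ≤ c := by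
  refine (hS _).conv_pure_le fun 𝔷 => ?_
  have h1 : a.conv (pure (S (a.ultraYoneda 𝔵))) y ≤ u + c :=
    (hS _).conv_pure_le fun 𝔷 =>
      (a.conv_le_ultraDist_add 𝔷 𝔵 y).trans (add_le_add_right h _)
  change _ ≤ a.conv 𝔷 (S (a.ultraYoneda 𝔵)) + u + c
  rw [add_assoc]
  exact (a.conv_triangle 𝔷 _ y).trans (add_le_add_right h1 _)

/-- Joint continuity of `(𝔵, u) ↦ α(𝔵) + u` for the compact topology of `UX`; in the second
variable only a lower bound for the limit is needed. -/
theorem conv_map_shift_eq_zero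
    (hadd : IsApproachMap (sumApproach a.toPseudoApproachSpace ennrealApproach)
      a.toPseudoApproachSpace (fun p => S (a.formalBall p)))
    (hult : IsApproachMap a.ultra a.toPseudoApproachSpace (fun 𝔵 => S (a.ultraYoneda 𝔵)))
    {W : Type*} (𝔴 : Ultrafilter W) (k : W → Ultrafilter X)
    (u : W → ℝ≥0∞) {𝔵 : Ultrafilter X} {v : ℝ≥0∞} (h𝔵 : ∀ A ∈ 𝔵, A ∈ ultraJoin (𝔴.map k))
    (hv : v ≤ xi (𝔴.map u)) :
    a.conv (𝔴.map fun w => shift S (k w) (u w)) (shift S 𝔵 v) = 0 := by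
  obtain rfl : ultraJoin (𝔴.map k) = 𝔵 := Ultrafilter.eq_of_le h𝔵
  have h1 := hadd (𝔴.map fun w => (S (a.ultraYoneda (k w)), u w))
    (S (a.ultraYoneda (ultraJoin (𝔴.map k))), v)
  have h2 := hult (𝔴.map k) (ultraJoin (𝔴.map k))
  change _ ≤ a.ultraDist _ _ at h2
  rw [a.ultraDist_self, Ultrafilter.map_map] at h2
  simp only [sumApproach, Ultrafilter.map_map] at h1
  refine nonpos_iff_eq_zero.1 (h1.trans ?_)
  refine (add_le_add h2 (tsub_eq_zero_of_le hv).le).trans (by simp)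

theorem eventually_mem_of_tendsto {W Z : Type*} {𝔴 : Filter W} {f : W → Ultrafilter Z}
    {i : Ultrafilter Z} (h : Tendsto f 𝔴 (𝓝 i)) {B : Set Z} (hB : B ∈ i) :
    ∀ᶠ w in 𝔴, B ∈ f w :=
  h.eventually ((ultrafilter_isOpen_basic B).mem_nhds hB)

/-- A family `z ↦ α(k z) + u z` indexed by a set `Z`, extended to an approach map on the compact
Hausdorff space `UZ` of ultrafilters by taking limits of `k` in `UX` and of `u` in `[0,∞]`. -/
noncomputable def shiftFamily
    (hadd : IsApproachMap (sumApproach a.toPseudoApproachSpace ennrealApproach)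
      a.toPseudoApproachSpace (fun p => S (a.formalBall p)))
    (hult : IsApproachMap a.ultra a.toPseudoApproachSpace (fun 𝔵 => S (a.ultraYoneda 𝔵)))
    {Z : Type*} (k : Z → Ultrafilter X) (u : Z → ℝ≥0∞) : a.PowSet (Ultrafilter Z) :=
  ⟨fun 𝔷 => shift S (ultraJoin (𝔷.map k)) (xi (𝔷.map u)), fun 𝔲 i => by
    by_cases hi : (𝔲 : Filter (Ultrafilter Z)) ≤ 𝓝 i
    · refine le_of_eq_of_le (conv_map_shift_eq_zero hadd hult 𝔲 _ _ (fun A hA => ?_) ?_) bot_le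
      · exact mem_ultraJoin_map.2 (eventually_mem_of_tendsto (f := id) hi hA)
      · refine le_of_forall_lt fun t ht => ?_
        obtain ⟨t', h1, h2⟩ := exists_between ht
        refine h1.trans_le (le_xi_map ?_)
        filter_upwards [eventually_mem_of_tendsto (f := id) hi (eventually_lt_of_lt_xi h2)]
          with 𝔷 h𝔷
        exact le_xi_map (Filter.Eventually.mono h𝔷 fun z hz => le_of_lt hz)
    · rw [topApproach_conv_of_not_le hi]
      exact le_top⟩

/-- If `φ` is close to `ψ` in `PX`, the epigraph of `φ` lies in a given neighbourhood of that of
`ψ ⊖ c`: otherwise points of the epigraphs outside the neighbourhood would have a limit in the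
compact space `UX` violating the convergence to `ψ`. -/
theorem eventually_forall_exists_mem_iff {𝔭 : Ultrafilter a.PSet} {ψ : a.PSet} {c : ℝ≥0∞}
    (hc : a.presheaf.conv 𝔭 ψ < c) (F : Finset (Set X)) (N : ℕ) :
    ∀ᶠ φ in (𝔭 : Filter a.PSet), ∀ 𝔶, ∃ 𝔵, (∀ A ∈ F, A ∈ 𝔶 ↔ A ∈ 𝔵) ∧
      min (ψ.1 𝔵 - c) N ≤ φ.1 𝔶 := by
  by_contra hn
  have hn' := Ultrafilter.eventually_not.2 hn
  have hex : ∀ φ : a.PSet, ∃ 𝔶, (¬∀ 𝔶, ∃ 𝔵, (∀ A ∈ F, A ∈ 𝔶 ↔ A ∈ 𝔵) ∧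
      min (ψ.1 𝔵 - c) N ≤ φ.1 𝔶) →
      ∀ 𝔵, (∀ A ∈ F, A ∈ 𝔶 ↔ A ∈ 𝔵) → φ.1 𝔶 < min (ψ.1 𝔵 - c) N := by
    intro φ
    by_cases h : ∀ 𝔶, ∃ 𝔵, (∀ A ∈ F, A ∈ 𝔶 ↔ A ∈ 𝔵) ∧ min (ψ.1 𝔵 - c) N ≤ φ.1 𝔶
    · obtain ⟨φ', hφ'⟩ := 𝔭.nonempty_of_mem hn'
      obtain ⟨𝔶, -⟩ := not_forall.1 hφ'
      exact ⟨𝔶, fun h' => absurd h h'⟩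
    · push Not at h
      obtain ⟨𝔶, h𝔶⟩ := h
      exact ⟨𝔶, fun _ => h𝔶⟩
  choose k hk using hex
  let 𝔵 := ultraJoin (𝔭.map k)
  have hF : ∀ᶠ φ in (𝔭 : Filter a.PSet), ∀ A ∈ F, A ∈ k φ ↔ A ∈ 𝔵 := by
    refine (Filter.eventually_all_finset F).2 fun A _ => ?_
    by_cases hA : A ∈ 𝔵
    · filter_upwards [mem_ultraJoin_map.1 hA] with φ hφ using iff_of_true hφ hA
    · filter_upwards [Ultrafilter.eventually_not.2 hA] with φ hφ using iff_of_false hφ hA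
  have hlt : ∀ᶠ φ in (𝔭 : Filter a.PSet), φ.1 (k φ) < min (ψ.1 𝔵 - c) N := by
    filter_upwards [hF, hn'] with φ h1 h2 using hk φ h2 𝔵 h1
  have hle : xi (𝔭.map fun φ => φ.1 (k φ)) ≤ min (ψ.1 𝔵 - c) N :=
    xi_map_le (hlt.mono fun φ h => h.le)
  obtain ⟨φ, hφ⟩ := hlt.exists
  have hcψ : c < ψ.1 𝔵 := tsub_pos_iff_lt.1 (bot_le.trans_lt (hφ.trans_le (min_le_left _ _)))
  have hfin : xi (𝔭.map fun φ => φ.1 (k φ)) ≠ ∞ :=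
    ((hle.trans (min_le_right _ _)).trans_lt (ENNReal.natCast_lt_top N)).ne
  have key := a.le_xi_add_presheaf_conv 𝔭 id k ψ
  rw [Ultrafilter.map_id] at key
  refine absurd key (not_le.2 ?_)
  calc _ < xi (𝔭.map fun φ => φ.1 (k φ)) + c := ENNReal.add_lt_add_left hfin hc
    _ ≤ (ψ.1 𝔵 - c) + c := add_le_add_left (hle.trans (min_le_left _ _)) _
    _ = ψ.1 𝔵 := tsub_add_cancel_of_le hcψ.le

/-- If `+`, `α` and all `⋁` are approach maps, then so is `Sup : PX → X`. -/
theorem IsSupMap.isApproachMap (hS : a.IsSupMap S)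
    (hadd : IsApproachMap (sumApproach a.toPseudoApproachSpace ennrealApproach)
      a.toPseudoApproachSpace (fun p => S (a.formalBall p)))
    (hult : IsApproachMap a.ultra a.toPseudoApproachSpace (fun 𝔵 => S (a.ultraYoneda 𝔵)))
    (hfam : ∀ (I : Type u) [TopologicalSpace I] [CompactSpace I] [T2Space I],
      IsApproachMap (powApproach (topApproach I) a.toPseudoApproachSpace)
        a.toPseudoApproachSpace (fun φ => S (a.family I φ))) :
    IsApproachMap a.presheaf a.toPseudoApproachSpace S := by
  classical
  intro 𝔭 ψ
  refine le_of_forall_gt_imp_ge_of_dense fun c hc => ?_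
  let k : Finset (Set X) → Ultrafilter X × Ultrafilter X → Ultrafilter X := fun F z =>
    if ∀ A ∈ F, A ∈ z.1 ↔ A ∈ z.2 then z.1 else z.2
  have hk : ∀ F z, ∀ A ∈ F, A ∈ k F z ↔ A ∈ z.2 := fun F z A hA => by
    by_cases h : ∀ A ∈ F, A ∈ z.1 ↔ A ∈ z.2
    · simp only [k, if_pos h, h A hA]
    · simp only [k, if_neg h]
  let v : Ultrafilter X × Ultrafilter X → ℝ≥0∞ := fun z => ψ.1 z.2 - c
  let Φ : Finset (Set X) × ℕ → a.PowSet (Ultrafilter (Ultrafilter X × Ultrafilter X)) := fun j =>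
    shiftFamily hadd hult (k j.1) fun z => min (v z) j.2
  let h : a.PowSet (Ultrafilter (Ultrafilter X × Ultrafilter X)) :=
    shiftFamily hadd hult Prod.snd v
  let 𝔮 : Ultrafilter (Finset (Set X) × ℕ) := Ultrafilter.of atTop
  have h𝔮 : (𝔮 : Filter (Finset (Set X) × ℕ)) ≤ atTop := Ultrafilter.of_le _
  -- The families `Φ j` converge to `h`, uniformly on the compact index space.
  have hlim : (powApproach (topApproach _) a.toPseudoApproachSpace).conv (𝔮.map Φ) h = 0 := by
    refine powApproach_topApproach_conv_eq_zero Φ 𝔮 h fun 𝔴 i h1 h2 => ?_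
    have hfst : Tendsto (Prod.fst : _ → Finset (Set X) × ℕ)
        (𝔴 : Filter (_ × Ultrafilter (Ultrafilter X × Ultrafilter X))) atTop :=
      le_trans (b := (𝔮 : Filter (Finset (Set X) × ℕ))) (by rw [← h1]; exact le_rfl) h𝔮
    refine conv_map_shift_eq_zero hadd hult 𝔴 _ _ (fun A hA => ?_) ?_
    · refine mem_ultraJoin_map.2 ?_
      filter_upwards [hfst.eventually_ge_atTop ({A}, 0), eventually_mem_of_tendsto h2 (mem_ultraJoin_map.1 hA)]
        with q h3 h4
      refine mem_ultraJoin_map.2 (Filter.Eventually.mono h4 fun z hz => ?_)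
      exact (hk _ _ A (h3.1 (Finset.mem_singleton_self A))).2 hz
    · refine le_of_forall_lt fun t ht => ?_
      obtain ⟨t', h3, h4⟩ := exists_between ht
      obtain ⟨N, hN⟩ := ENNReal.exists_nat_gt h4.ne_top
      refine h3.trans_le (le_xi_map ?_)
      filter_upwards [hfst.eventually_ge_atTop (∅, N), eventually_mem_of_tendsto h2 (eventually_lt_of_lt_xi h4)]
        with q h5 h6
      refine le_xi_map (Filter.Eventually.mono h6 fun z hz => le_min (le_of_lt hz) ?_)
      exact hN.le.trans (Nat.cast_le.2 h5.2)
  have hconv : a.conv (𝔮.map fun j => S (a.family _ (Φ j))) (S (a.family _ h)) = 0 := by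
    have h1 := hfam _ (𝔮.map Φ) h
    rw [hlim, Ultrafilter.map_map] at h1
    exact nonpos_iff_eq_zero.1 h1
  -- All members of `h` are within `c` of `Sup ψ`, hence so is their supremum.
  have hle : a.conv (pure (S (a.family _ h))) (S ψ) ≤ c := by
    refine (hS _).conv_pure_le fun 𝔷 => ?_
    rw [← tsub_le_iff_right]
    refine le_iInf fun i => ?_
    rw [tsub_le_iff_right]
    refine (a.conv_triangle 𝔷 (h.1 i) _).trans (add_le_add_right ?_ _)
    refine hS.conv_pure_shift_le (((hS ψ).conv_le _).trans ((ψ.ultraJoin_le _).trans ?_))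
    rw [Ultrafilter.map_map]
    exact xi_map_le_xi_map_sub_add i _ c
  -- For every `j`, `Sup φ` lies below the supremum of `Φ j` for `𝔭`-most `φ`.
  have hdist : a.ultraDist (𝔭.map S) (𝔮.map fun j => S (a.family _ (Φ j))) = 0 := by
    refine a.ultraDist_map_map_eq_zero (.of_forall fun j => ?_)
    filter_upwards [eventually_forall_exists_mem_iff hc j.1 j.2] with φ hφ
    refine (hS φ).le fun 𝔶 => ?_
    obtain ⟨𝔵, h1, h2⟩ := hφ 𝔶
    -- The member of `Φ j` at the principal ultrafilter of `(𝔶, 𝔵)` is `α(𝔶) + min (ψ 𝔵 ⊖ c) N`.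
    have h3 : (Φ j).1 (pure (𝔶, 𝔵)) = shift S 𝔶 (min (ψ.1 𝔵 - c) j.2) := by
      change shift S (ultraJoin ((pure (𝔶, 𝔵) : Ultrafilter _).map _))
        (xi ((pure (𝔶, 𝔵) : Ultrafilter _).map _)) = _
      rw [Ultrafilter.map_pure, Ultrafilter.map_pure, ultraJoin_pure, xi_pure]
      simp only [k, v, if_pos h1]
    have h4 : a.conv (pure ((Φ j).1 (pure (𝔶, 𝔵)))) (S (a.family _ (Φ j))) ≤ 0 :=
      ((hS (a.family _ (Φ j))).conv_le _).trans ((iInf_le _ (pure (𝔶, 𝔵))).trans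
        (a.conv_pure _).le)
    refine (a.conv_triangle 𝔶 _ _).trans ((add_le_add_right h4 _).trans ?_)
    rw [add_zero, h3]
    exact (hS.conv_shift_le 𝔶 _).trans h2
  calc a.conv (𝔭.map S) (S ψ)
      ≤ _ := a.conv_le_ultraDist_add _ (𝔮.map fun j => S (a.family _ (Φ j))) _
    _ ≤ 0 + (0 + c) := add_le_add hdist.le
        ((a.conv_triangle _ (S (a.family _ h)) _).trans (add_le_add hconv.le hle))
    _ = c := by simp

end Reconstruction

end ApproachSpace

theorem mainTheorem8 {X : Type u} (a : ApproachSpace X) :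
    a.AbsolutelyCocomplete ↔
      a.Cocomplete ∧
        ∀ S : a.PSet → X, a.IsSupMap S →
          IsApproachMap (sumApproach a.toPseudoApproachSpace ennrealApproach)
              a.toPseudoApproachSpace (fun p => S (a.formalBall p)) ∧
          IsApproachMap a.ultra a.toPseudoApproachSpace (fun 𝔵 => S (a.ultraYoneda 𝔵)) ∧
          ∀ (I : Type u) [TopologicalSpace I] [CompactSpace I] [T2Space I],
            IsApproachMap (powApproach (topApproach I) a.toPseudoApproachSpace)
              a.toPseudoApproachSpace (fun φ => S (a.family I φ)) := by
  constructor
  · rintro ⟨L, hL⟩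
    have hLs := a.isSupremum_of_isApproachAdjunction hL
    refine ⟨fun ψ => ⟨L ψ, hLs ψ⟩, fun S hS => ?_⟩
    have h := hS.isApproachMap_of_isApproachMap hLs hL.1
    exact ⟨h.comp a.isApproachMap_formalBall, h.comp a.isApproachMap_ultraYoneda,
      fun I _ _ _ => h.comp (a.isApproachMap_family I)⟩
  · rintro ⟨hc, h⟩
    choose S hS using hc
    obtain ⟨hadd, hult, hfam⟩ := h S hS
    exact ⟨S, ApproachSpace.IsSupMap.isApproachAdjunction hS
      (ApproachSpace.IsSupMap.isApproachMap hS hadd hult hfam)⟩
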